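/- Let $n \in \mathbb{N}$ and $[n] = \{1, \dots, n\}$. **Weak order.** For a reflexive relation $R \subseteq [n]^2$, let $R^{\mathrm{Inc}} = \{(a,b) \in R : a \le b\}$ and $R^{\mathrm{Dec}} = \{(b,a) \in R : a \le b\}$. The weak order on reflexive relations on $[n]$ is defined by $R \preccurlyeq S$ if and only if $R^{\mathrm{Inc}} \supseteq S^{\mathrm{Inc}}$ and $R^{\mathrm{Dec}} \subseteq S^{\mathrm{Dec}}$. For permutations $\sigma, \tau$ of $[n]$, $\sigma \preccurlyeq \tau$ means $\mathrm{inv}(\sigma) \subseteq \mathrm{inv}(\tau)$, where $\mathrm{inv}(\sigma) = \{(b,a) : a \le b,\ \sigma^{-1}(a) \ge \sigma^{-1}(b)\}$. **Weak order interval posets.** A permutation $\sigma$ gives the total order $\vartriangleleft_\sigma$ on $[n]$ with $u \vartriangleleft_\sigma v$ if and only if $\sigma^{-1}(u) \le \sigma^{-1}(v)$. Let $\mathrm{WOIP}(n)$ be the set of all relations $\bigcap_{\sigma \preccurlyeq \tau \preccurlyeq \sigma'} \vartriangleleft_\tau$ for permutations $\sigma \preccurlyeq \sigma'$ of $[n]$.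 **Permutree element posets.** An orientation $\delta = (n, \delta^+, \delta^-)$ of $[n]$ consists of two arbitrary subsets $\delta^+, \delta^- \subseteq [n]$. A permutree with orientation $\delta$ is a directed tree $T$ with vertex set $[n]$ such that each vertex $v$ has two parents (outgoing neighbours), one left and one right, if $v \in \delta^+$ and one parent otherwise, and has two children (incoming neighbours), one left and one right, if $v \in \delta^-$ and one child otherwise, where each of these parents and children may be empty (a dangling edge); moreover, if $v \in \delta^+$ (resp. $v \in \delta^-$), all labels in the left ancestor (resp. descendant) subtree of $v$ are smaller than $v$ and all labels in the right one are larger than $v$. Here an ancestor (resp. descendant) subtree of $v$ is the connected component containing the corresponding parent (resp. child) once the edge joining it to $v$ is removed. Let $\vartriangleleft_T$ be the relation on $[n]$ with $i \vartriangleleft_T j$ if and only if there is an oriented path (possibly of length $0$) from $i$ to $j$ in $T$, and let $\mathrm{PEP}(\delta)$ be the set of all $\vartriangleleft_T$ for $T$ a permutree with orientation $\delta$. **Theorem.** The weak order on $\mathrm{WOIP}(n)$ is a lattice, and for every orientation $\delta$ of $[n]$, $\mathrm{PEP}(\delta)$ induces a sublattice of this lattice: $\mathrm{PEP}(\delta)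 \subseteq \mathrm{WOIP}(n)$, and for all $R, S \in \mathrm{PEP}(\delta)$, the meet $R \wedge_{\mathrm{WOIP}} S$ and the join $R \vee_{\mathrm{WOIP}} S$ of $R$ and $S$ in $(\mathrm{WOIP}(n), \preccurlyeq)$ belong to $\mathrm{PEP}(\delta)$. -/

import Mathlib

/-!
Integer relations, the weak order on them, weak order interval posets and permutree element posets.
The ground set `{1, …, n}` is modelled by `Fin n` with its natural order.
-/

/-- A reflexive binary relation on the ground set `[n]`. -/
@[ext]
structure IRel (n : ℕ) where
  rel : Fin n → Fin n → Prop
  refl : ∀ u, rel u u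

namespace IRel

variable {n : ℕ}

/-- The increasing subrelation: the pairs `(a, b)` of the relation with `a ≤ b`. -/
def inc (R : IRel n) : Set (Fin n × Fin n) := {p | p.1 ≤ p.2 ∧ R.rel p.1 p.2}

/-- The decreasing subrelation: the pairs `(b, a)` of the relation with `a ≤ b`. -/
def dec (R : IRel n) : Set (Fin n × Fin n) := {p | p.2 ≤ p.1 ∧ R.rel p.1 p.2}

/-- The weak order on reflexive relations on `[n]`: `R ≤ S` means that the increasing subrelation
of `R` contains that of `S` and the decreasing subrelation of `R` is contained in that of `S`. -/
instance : PartialOrder (IRel n) where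
  le R S := S.inc ⊆ R.inc ∧ R.dec ⊆ S.dec
  le_refl R := ⟨subset_rfl, subset_rfl⟩
  le_trans R S T h k := ⟨k.1.trans h.1, h.2.trans k.2⟩
  le_antisymm R S h k := by
    ext u v
    rcases le_total u v with huv | huv
    · exact ⟨fun hR => (k.1 (show (u, v) ∈ R.inc from ⟨huv, hR⟩)).2,
        fun hS => (h.1 (show (u, v) ∈ S.inc from ⟨huv, hS⟩)).2⟩
    · exact ⟨fun hR => (h.2 (show (u, v) ∈ R.dec from ⟨huv, hR⟩)).2,
        fun hS => (k.2 (show (u, v) ∈ S.dec from ⟨huv, hS⟩)).2⟩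

end IRel

/-- The inversions of `σ`: the pairs `(b, a)` of values with `a ≤ b` and
`σ⁻¹ b ≤ σ⁻¹ a`. -/
def permInv {n : ℕ} (σ : Equiv.Perm (Fin n)) : Set (Fin n × Fin n) :=
  {p | p.2 ≤ p.1 ∧ σ.symm p.1 ≤ σ.symm p.2}

/-- The weak order on permutations: inclusion of inversion sets. -/
def PermWeakLE {n : ℕ} (σ τ : Equiv.Perm (Fin n)) : Prop := permInv σ ⊆ permInv τ

/-- The total order on `[n]` given by a permutation `σ`:
`u` is below `v` when `u` appears (weakly) before `v` in the word `σ 1, …, σ n`. -/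
def permRel {n : ℕ} (σ : Equiv.Perm (Fin n)) : IRel n where
  rel u v := σ.symm u ≤ σ.symm v
  refl _ := le_rfl

/-- The intersection of the total orders of all permutations of the weak order interval
`[σ, σ']`. -/
def permIntervalRel {n : ℕ} (σ σ' : Equiv.Perm (Fin n)) : IRel n where
  rel u v := ∀ τ, PermWeakLE σ τ → PermWeakLE τ σ' → (permRel τ).rel u v
  refl u τ _ _ := (permRel τ).refl u

/-- The set of weak order interval posets on `[n]`. -/
def WOIP (n : ℕ) : Set (IRel n) :=
  {R | ∃ σ σ' : Equiv.Perm (Fin n), PermWeakLE σ σ' ∧ R = permIntervalRel σ σ'}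

/-- An orientation of `[n]`: two arbitrary subsets `δ⁺` and `δ⁻` of `[n]`. -/
structure PermutreeOrientation (n : ℕ) where
  pos : Set (Fin n)
  neg : Set (Fin n)

/-- The vertex set of the subtree that hangs at `v` through its neighbour `w`: the vertices
connected to `w` (by unoriented paths) once the edge between `v` and `w` is removed. -/
def hangingSubtree {n : ℕ} (G : SimpleGraph (Fin n)) (v w : Fin n) : Set (Fin n) :=
  {u | (G.deleteEdges {s(v, w)}).Reachable w u}

/-- A permutree with orientation `δ`, with each vertex identified with its label in `[n]`.
It is a directed tree, where `edge v w` means that `w` is a parent of `v`.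
A vertex has two parents (a left one and a right one) if it is in `δ⁺` and one parent otherwise,
and two children if it is in `δ⁻` and one child otherwise. As usual for binary trees and
permutrees, each of these parents and children may be empty (a dangling edge), so that
the actual neighbours are at most as many as prescribed. -/
structure Permutree {n : ℕ} (δ : PermutreeOrientation n) where
  edge : Fin n → Fin n → Prop
  /-- Every edge has exactly one direction (and there are no loops). -/
  asymm : ∀ u v, edge u v → ¬ edge v u
  /-- The underlying undirected graph is a tree. -/
  isTree : (SimpleGraph.fromRel edge).IsTree
  /-- A vertex outside `δ⁺` has a single (possibly empty) parent. -/
  one_parent : ∀ v, v ∉ δ.pos → ∀ w w', edge v w → edge v w' → w = w'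
  /-- A vertex outside `δ⁻` has a single (possibly empty) child. -/
  one_child : ∀ v, v ∉ δ.neg → ∀ w w', edge w v → edge w' v → w = w'
  /-- A vertex of `δ⁺` has at most one left parent and at most one right parent. -/
  two_parents : ∀ v ∈ δ.pos, ∀ w w', edge v w → edge v w' → (w < v ↔ w' < v) → w = w'
  /-- A vertex of `δ⁻` has at most one left child and at most one right child. -/
  two_children : ∀ v ∈ δ.neg, ∀ w w', edge w v → edge w' v → (w < v ↔ w' < v) → w = w'
  /-- At a vertex `v` of `δ⁺`, an ancestor subtree has all its labels smaller than `v` (if it is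
  the left one) or all its labels larger than `v` (if it is the right one). -/
  ancestor_subtrees : ∀ v ∈ δ.pos, ∀ w, edge v w →
    (∀ u ∈ hangingSubtree (SimpleGraph.fromRel edge) v w, u < v) ∨
      (∀ u ∈ hangingSubtree (SimpleGraph.fromRel edge) v w, v < u)
  /-- The same condition on the descendant subtrees at a vertex of `δ⁻`. -/
  descendant_subtrees : ∀ v ∈ δ.neg, ∀ w, edge w v →
    (∀ u ∈ hangingSubtree (SimpleGraph.fromRel edge) v w, u < v) ∨
      (∀ u ∈ hangingSubtree (SimpleGraph.fromRel edge) v w, v < u)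

/-- The relation of a permutree: `i` is below `j` when there is an oriented path (possibly of
length zero) from `i` to `j`. -/
def Permutree.toIRel {n : ℕ} {δ : PermutreeOrientation n} (T : Permutree δ) : IRel n where
  rel := Relation.ReflTransGen T.edge
  refl _ := Relation.ReflTransGen.refl

/-- The set of permutree element posets of orientation `δ`. -/
def PEP {n : ℕ} (δ : PermutreeOrientation n) : Set (IRel n) :=
  Set.range (Permutree.toIRel (δ := δ))

/-! Both families have local descriptions. A relation is a weak order interval poset iff it is a
poset in which `a ⊲ c`, with the value `b` strictly between `a` and `c`, forces `a ⊲ b` or `b ⊲ c`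
(`mem_WOIP_iff`). For nonempty `[n]` it comes from a permutree iff, moreover, `b ∈ δ⁺` forces `a ⊲
b`, `b ∈ δ⁻` forces `b ⊲ c`, and each incomparable pair has a value between its two members that
lies in `δ⁺` and is above neither, or in `δ⁻` and is below neither (`mem_PEP_iff`).

The join is explicit (`joinRel`): its decreasing pairs are the transitive closure of those of `R`
and `S`, and its missing increasing pairs are the transitive closure of those missing from `R` or
`S`. Chains in these closures are monotone in value, so the local conditions pass from single steps
to chains (`isIntervalPoset_joinRel`, `isPermutreePoset_joinRel`). Meets follow by reversing
relations, which exchanges `δ⁺` and `δ⁻`.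

The hard half of `mem_PEP_iff` is that the Hasse diagram is a permutree: `exists_cut` attaches to
each cover a cut that no other cover crosses. -/

/-- `b` lies strictly between `a` and `c`, in either order. -/
def StrictlyBetween {n : ℕ} (a b c : Fin n) : Prop := (a < b ∧ b < c) ∨ (c < b ∧ b < a)

theorem StrictlyBetween.symm {n : ℕ} {a b c : Fin n} (h : StrictlyBetween a b c) :
    StrictlyBetween c b a := Or.symm h

namespace IRel

variable {n : ℕ}

/-- The opposite relation. -/
def op (R : IRel n) : IRel n where
  rel u v := R.rel v u
  refl := R.refl

@[simp] theorem op_rel (R : IRel n) (u v : Fin n) : R.op.rel u v ↔ R.rel v u := Iff.rfl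

theorem le_iff (R S : IRel n) : R ≤ S ↔ ∀ a b : Fin n, a < b →
    (S.rel a b → R.rel a b) ∧ (R.rel b a → S.rel b a) := by
  constructor
  · intro h a b hab
    exact ⟨fun hS => (h.1 (show (a, b) ∈ S.inc from ⟨hab.le, hS⟩)).2,
      fun hR => (h.2 (show (b, a) ∈ R.dec from ⟨hab.le, hR⟩)).2⟩
  · intro h
    constructor
    · rintro ⟨a, b⟩ ⟨hab, hS⟩
      rcases eq_or_lt_of_le hab with h' | h'
      · obtain rfl : a = b := h'
        exact ⟨hab, R.refl _⟩
      · exact ⟨hab, (h a b h').1 hS⟩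
    · rintro ⟨b, a⟩ ⟨hab, hR⟩
      rcases eq_or_lt_of_le hab with h' | h'
      · obtain rfl : a = b := h'
        exact ⟨hab, S.refl _⟩
      · exact ⟨hab, (h a b h').2 hR⟩

theorem op_le_op {R S : IRel n} (h : R ≤ S) : S.op ≤ R.op := by
  rw [le_iff] at h ⊢
  exact fun a b hab => ⟨(h a b hab).2, (h a b hab).1⟩

end IRel

/-! ### Interval posets and their extremal linear extensions -/

/-- The local characterization of weak order interval posets. -/
structure IsIntervalPoset {n : ℕ} (R : IRel n) : Prop where
  antisymm : ∀ u v, R.rel u v → R.rel v u → u = v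
  trans : ∀ u v w, R.rel u v → R.rel v w → R.rel u w
  split : ∀ a b c, StrictlyBetween a b c → R.rel a c → R.rel a b ∨ R.rel b c

theorem IsIntervalPoset.op {n : ℕ} {R : IRel n} (h : IsIntervalPoset R) :
    IsIntervalPoset R.op where
  antisymm u v h₁ h₂ := h.antisymm u v h₂ h₁
  trans u v w h₁ h₂ := h.trans w v u h₂ h₁
  split a b c hb hac := (h.split c b a hb.symm hac).symm

/-- It suffices to check transitivity when the middle element is also the middle value. -/
theorem IsIntervalPoset.of_trans_between {n : ℕ} {R : IRel n}
    (antisymm : ∀ u v, R.rel u v → R.rel v u → u = v)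
    (trans : ∀ a b c, StrictlyBetween a b c → R.rel a b → R.rel b c → R.rel a c)
    (split : ∀ a b c, StrictlyBetween a b c → R.rel a c → R.rel a b ∨ R.rel b c) :
    IsIntervalPoset R where
  antisymm := antisymm
  split := split
  trans u v w huv hvw := by
    by_cases h1 : u = v
    · exact h1 ▸ hvw
    by_cases h2 : v = w
    · exact h2 ▸ huv
    by_cases h3 : u = w
    · exact h3 ▸ R.refl _
    -- If `u` or `w` is the middle value, `split` is applied to the pair on either side of it;
    -- antisymmetry excludes the unwanted alternative.
    have h4 := trans u v w
    have h5 := split v u w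
    have h6 := split u w v
    have h7 := antisymm u v huv
    have h8 := antisymm v w hvw
    unfold StrictlyBetween at h4 h5 h6
    grind

theorem exists_perm_of_linear {n : ℕ} (r : Fin n → Fin n → Prop) (hrefl : ∀ u, r u u)
    (hanti : ∀ u v, r u v → r v u → u = v) (htrans : ∀ u v w, r u v → r v w → r u w)
    (htotal : ∀ u v, r u v ∨ r v u) :
    ∃ σ : Equiv.Perm (Fin n), ∀ u v, σ.symm u ≤ σ.symm v ↔ r u v := by
  classical
  let f : Fin n → ℕ := fun u => (Finset.univ.filter fun z => r z u ∧ z ≠ u).card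
  have hlt : ∀ u v, r u v → u ≠ v → f u < f v := by
    intro u v huv hne
    apply Finset.card_lt_card
    rw [Finset.ssubset_iff_of_subset]
    · exact ⟨u, by simp [huv, hne], by simp⟩
    · intro z hz
      simp only [Finset.mem_filter, Finset.mem_univ, true_and] at hz ⊢
      refine ⟨htrans z u v hz.1 huv, ?_⟩
      rintro rfl
      exact hne (hanti u z huv hz.1)
  have hf : ∀ u, f u < n := by
    intro u
    calc f u < (Finset.univ : Finset (Fin n)).card := by
          apply Finset.card_lt_card
          rw [Finset.ssubset_iff_of_subset (Finset.subset_univ _)]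
          exact ⟨u, by simp, by simp⟩
      _ = n := by simp
  have hle : ∀ u v, f u ≤ f v ↔ r u v := by
    intro u v
    by_cases huv : u = v
    · subst huv; simp [hrefl]
    constructor
    · intro h
      rcases htotal u v with h' | h'
      · exact h'
      · exact absurd (hlt v u h' (Ne.symm huv)) (by omega)
    · exact fun h => (hlt u v h huv).le
  let g : Fin n → Fin n := fun u => ⟨f u, hf u⟩
  have hg : Function.Injective g := by
    intro u v h
    have h' : f u = f v := congrArg Fin.val h
    exact hanti u v ((hle u v).1 h'.le) ((hle v u).1 h'.ge)
  refine ⟨(Equiv.ofBijective g (Finite.injective_iff_bijective.1 hg)).symm, fun u v => ?_⟩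
  exact hle u v

/-- The linear extension of an interval poset with the same decreasing subrelation. -/
theorem IsIntervalPoset.exists_perm {n : ℕ} {R : IRel n} (h : IsIntervalPoset R) :
    ∃ σ : Equiv.Perm (Fin n), ∀ u v, σ.symm u ≤ σ.symm v ↔
      (u = v ∨ (u < v ∧ ¬ R.rel v u) ∨ (v < u ∧ R.rel u v)) := by
  apply exists_perm_of_linear
  · exact fun u => Or.inl rfl
  · intro u v h₁ h₂
    grind
  · intro u v w h₁ h₂
    have e1 := h.trans u v w
    have e2 := h.trans w v u
    have e9 := h.trans v w u
    have e10 := h.trans w u v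
    have e3 := h.split v u w
    have e4 := h.split u v w
    have e5 := h.split w u v
    have e6 := h.split u w v
    have e7 := h.split w v u
    have e8 := h.split v w u
    unfold StrictlyBetween at e3 e4 e5 e6 e7 e8
    grind
  · intro u v
    grind

section IntervalRel

variable {n : ℕ} {σ σ' : Equiv.Perm (Fin n)}

/-- Every inversion of a permutation in the interval is one of `σ'`, so `σ'` alone decides the
increasing pairs; dually, `σ` decides the decreasing ones. -/
theorem permIntervalRel_inc (h : PermWeakLE σ σ') {a b : Fin n} (hab : a < b) :
    (permIntervalRel σ σ').rel a b ↔ σ'.symm a ≤ σ'.symm b := by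
  constructor
  · exact fun H => H σ' h subset_rfl
  · intro H τ _ hτ
    by_contra hlt
    have hmem : (b, a) ∈ permInv τ := ⟨hab.le, (not_le.1 hlt).le⟩
    exact hab.ne (σ'.symm.injective (le_antisymm H (hτ hmem).2))

theorem permIntervalRel_dec (h : PermWeakLE σ σ') {a b : Fin n} (hab : a < b) :
    (permIntervalRel σ σ').rel b a ↔ σ.symm b ≤ σ.symm a := by
  constructor
  · exact fun H => H σ subset_rfl h
  · intro H τ hτ _
    exact (hτ (show (b, a) ∈ permInv σ from ⟨hab.le, H⟩)).2

theorem isIntervalPoset_permIntervalRel (h : PermWeakLE σ σ') :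
    IsIntervalPoset (permIntervalRel σ σ') where
  antisymm u v h₁ h₂ :=
    σ.symm.injective (le_antisymm (h₁ σ subset_rfl h) (h₂ σ subset_rfl h))
  trans u v w h₁ h₂ τ hτ hτ' := le_trans (h₁ τ hτ hτ') (h₂ τ hτ hτ')
  split a b c hb hac := by
    rcases hb with ⟨hab, hbc⟩ | ⟨hcb, hba⟩
    · rw [permIntervalRel_inc h hab, permIntervalRel_inc h hbc]
      rw [permIntervalRel_inc h (hab.trans hbc)] at hac
      exact (le_total _ _).imp_right fun h' => h'.trans hac
    · rw [permIntervalRel_dec h hba, permIntervalRel_dec h hcb]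
      rw [permIntervalRel_dec h (hcb.trans hba)] at hac
      exact (le_total _ _).imp_right fun h' => h'.trans hac

end IntervalRel

theorem mem_WOIP_iff {n : ℕ} {R : IRel n} : R ∈ WOIP n ↔ IsIntervalPoset R := by
  constructor
  · rintro ⟨σ, σ', h, rfl⟩
    exact isIntervalPoset_permIntervalRel h
  · intro h
    obtain ⟨σ, hσ⟩ := h.exists_perm
    -- `σ` lists incomparable pairs in increasing order. Reversing the word of `ρ`, built from the
    -- opposite poset, gives the linear extension `σ'` that lists them in decreasing order.
    obtain ⟨ρ, hρ⟩ := h.op.exists_perm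
    simp only [IRel.op_rel] at hρ
    obtain ⟨σ', hσ'⟩ := exists_perm_of_linear (fun u v => ρ.symm v ≤ ρ.symm u) (fun u => le_rfl)
      (fun u v h₁ h₂ => ρ.symm.injective (le_antisymm h₂ h₁)) (fun u v w h₁ h₂ => h₂.trans h₁)
      (fun u v => le_total _ _)
    have hle : PermWeakLE σ σ' := by
      rintro ⟨b, a⟩ ⟨hab, H⟩
      refine ⟨hab, ?_⟩
      rw [hσ] at H
      rw [hσ', hρ]
      have := h.antisymm a b
      grind
    refine ⟨σ, σ', hle, ?_⟩
    ext u v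
    rcases lt_trichotomy u v with huv | rfl | huv
    · rw [permIntervalRel_inc hle huv, hσ', hρ]
      grind
    · exact iff_of_true (R.refl _) (IRel.refl _ _)
    · rw [permIntervalRel_dec hle huv, hσ]
      grind

/-! ### Local conditions for permutree posets -/

/-- Exchanging the roles of parents and children. -/
def PermutreeOrientation.op {n : ℕ} (δ : PermutreeOrientation n) : PermutreeOrientation n where
  pos := δ.neg
  neg := δ.pos

/-- The local characterization of permutree element posets. -/
structure IsPermutreePoset {n : ℕ} (δ : PermutreeOrientation n) (R : IRel n) : Prop
    extends IsIntervalPoset R where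
  pos : ∀ a b c, StrictlyBetween a b c → b ∈ δ.pos → R.rel a c → R.rel a b
  neg : ∀ a b c, StrictlyBetween a b c → b ∈ δ.neg → R.rel a c → R.rel b c
  incomparable : ∀ a c, a < c → ¬ R.rel a c → ¬ R.rel c a → ∃ b, a < b ∧ b < c ∧
    ((b ∈ δ.pos ∧ ¬ R.rel a b ∧ ¬ R.rel c b) ∨ (b ∈ δ.neg ∧ ¬ R.rel b a ∧ ¬ R.rel b c))

theorem IsPermutreePoset.op {n : ℕ} {δ : PermutreeOrientation n} {R : IRel n}
    (h : IsPermutreePoset δ R) : IsPermutreePoset δ.op R.op where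
  toIsIntervalPoset := h.toIsIntervalPoset.op
  pos a b c hb hδ hac := h.neg c b a hb.symm hδ hac
  neg a b c hb hδ hac := h.pos c b a hb.symm hδ hac
  incomparable a c hac h₁ h₂ := by
    obtain ⟨b, hab, hbc, H⟩ := h.incomparable a c hac h₂ h₁
    exact ⟨b, hab, hbc, H.symm⟩

/-! ### Transitive closures of decreasing relations -/

section TransGen

open Relation

variable {α : Type*} [LinearOrder α] {Q : α → α → Prop}

theorem transGen_lt (hQ : ∀ u v, Q u v → v < u) {u v : α} (h : TransGen Q u v) : v < u := by
  induction h with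
  | single h => exact hQ _ _ h
  | tail _ h ih => exact (hQ _ _ h).trans ih

/-- A chain from `c` down to `a` either visits `b` or jumps over it in one step, where `hco`
applies. The next two lemmas use the same argument. -/
theorem transGen_cotrans
    (hco : ∀ a b c, a < b → b < c → Q c a → Q c b ∨ Q b a) {c a : α} (h : TransGen Q c a) :
    ∀ b, a < b → b < c → TransGen Q c b ∨ TransGen Q b a := by
  induction h with
  | single h =>
    exact fun b hab hbc => (hco _ b _ hab hbc h).imp TransGen.single TransGen.single
  | @tail x a hcx hxa ih =>
    intro b hab hbc
    rcases lt_trichotomy b x with hbx | rfl | hxb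
    · exact (hco _ b _ hab hbx hxa).imp hcx.tail TransGen.single
    · exact Or.inl hcx
    · exact (ih b hxb hbc).imp_right fun h => h.tail hxa

theorem transGen_left {p : α → Prop}
    (hp : ∀ a b c, a < b → b < c → p b → Q c a → Q c b) {c a : α} (h : TransGen Q c a) :
    ∀ b, a < b → b < c → p b → TransGen Q c b := by
  induction h with
  | single h => exact fun b hab hbc hb => TransGen.single (hp _ b _ hab hbc hb h)
  | @tail x a hcx hxa ih =>
    intro b hab hbc hb
    rcases lt_trichotomy b x with hbx | rfl | hxb
    · exact hcx.tail (hp _ b _ hab hbx hb hxa)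
    · exact hcx
    · exact ih b hxb hbc hb

theorem transGen_right {p : α → Prop}
    (hp : ∀ a b c, a < b → b < c → p b → Q c a → Q b a) {c a : α} (h : TransGen Q c a) :
    ∀ b, a < b → b < c → p b → TransGen Q b a := by
  induction h with
  | single h => exact fun b hab hbc hb => TransGen.single (hp _ b _ hab hbc hb h)
  | @tail x a hcx hxa ih =>
    intro b hab hbc hb
    rcases lt_trichotomy b x with hbx | rfl | hxb
    · exact TransGen.single (hp _ b _ hab hbx hb hxa)
    · exact TransGen.single hxa
    · exact (ih b hxb hbc hb).tail hxa

/-- Only the last step of the chain has to be prolonged; in `transGen_extend_right`, only the first.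
-/
theorem transGen_extend_left (hQ : ∀ u v, Q u v → v < u) {p : α → Prop}
    (hp : ∀ a b c, a < b → b < c → p b → Q c b → Q c a) {c b : α} (h : TransGen Q c b)
    (hb : p b) {a : α} (hab : a < b) : TransGen Q c a := by
  cases h with
  | single h => exact TransGen.single (hp a _ _ hab (hQ _ _ h) hb h)
  | tail hcx hxb => exact hcx.tail (hp a _ _ hab (hQ _ _ hxb) hb hxb)

theorem transGen_extend_right (hQ : ∀ u v, Q u v → v < u) {p : α → Prop}
    (hp : ∀ a b c, a < b → b < c → p b → Q b a → Q c a) {b a : α} (h : TransGen Q b a)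
    (hb : p b) {c : α} (hbc : b < c) : TransGen Q c a := by
  induction h with
  | single h => exact TransGen.single (hp _ _ c (hQ _ _ h) hbc hb h)
  | tail _ hxb ih => exact ih.tail hxb

end TransGen

/-! ### Relations given by decreasing pairs and missing increasing pairs -/

namespace IRel

variable {n : ℕ}

/-- The relation whose strict decreasing pairs are those of `K` and whose strict increasing pairs
are those whose reversal is not in `F`. -/
def ofPair (K F : Fin n → Fin n → Prop) : IRel n where
  rel u v := u = v ∨ (v < u ∧ K u v) ∨ (u < v ∧ ¬ F v u)
  refl _ := Or.inl rfl

variable {K F : Fin n → Fin n → Prop}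

theorem ofPair_inc {a b : Fin n} (h : a < b) : (ofPair K F).rel a b ↔ ¬ F b a := by
  simp [ofPair, h, h.ne, h.not_gt]

theorem ofPair_dec {a b : Fin n} (h : a < b) : (ofPair K F).rel b a ↔ K b a := by
  simp [ofPair, h, h.ne', h.not_gt]

/-- `F` enters through its complement, which swaps the axioms: transitivity of `F` is splitting of
increasing pairs, and splitting of `F` is their transitivity. Antisymmetry is `K ⊆ F`. -/
theorem isIntervalPoset_ofPair (hKF : ∀ u v, K u v → F u v)
    (hK : ∀ a b c, a < b → b < c → K c b → K b a → K c a)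
    (hK' : ∀ a b c, a < b → b < c → K c a → K c b ∨ K b a)
    (hF : ∀ a b c, a < b → b < c → F c b → F b a → F c a)
    (hF' : ∀ a b c, a < b → b < c → F c a → F c b ∨ F b a) :
    IsIntervalPoset (ofPair K F) := by
  apply IsIntervalPoset.of_trans_between
  · intro u v h₁ h₂
    have := hKF u v
    have := hKF v u
    simp only [ofPair] at h₁ h₂
    grind
  · rintro a b c (⟨hab, hbc⟩ | ⟨hab, hbc⟩)
    · rw [ofPair_inc hab, ofPair_inc hbc, ofPair_inc (hab.trans hbc)]
      have := hF' a b c hab hbc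
      tauto
    · rw [ofPair_dec hab, ofPair_dec hbc, ofPair_dec (hab.trans hbc)]
      exact fun h₁ h₂ => hK c b a hab hbc h₁ h₂
  · rintro a b c (⟨hab, hbc⟩ | ⟨hab, hbc⟩)
    · rw [ofPair_inc hab, ofPair_inc hbc, ofPair_inc (hab.trans hbc)]
      have := hF a b c hab hbc
      tauto
    · rw [ofPair_dec hab, ofPair_dec hbc, ofPair_dec (hab.trans hbc)]
      exact hK' c b a hab hbc

end IRel

/-- A one-sided witness of incomparability can be improved to a two-sided one. -/
theorem exists_separating {n : ℕ} {δ : PermutreeOrientation n} {K F : Fin n → Fin n → Prop}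
    (hKF : ∀ u v, K u v → F u v)
    (hK : ∀ a b c, K c b → K b a → K c a) (hF : ∀ a b c, F c b → F b a → F c a)
    (hex : ∀ a c, F c a → ¬ K c a → ∃ b, a < b ∧ b < c ∧
      ((b ∈ δ.pos ∧ F b a) ∨ (b ∈ δ.neg ∧ F c b))) :
    ∀ (m : ℕ) (a c : Fin n), c.val - a.val < m → F c a → ¬ K c a → ∃ b, a < b ∧ b < c ∧
      ((b ∈ δ.pos ∧ F b a ∧ ¬ K c b) ∨ (b ∈ δ.neg ∧ ¬ K b a ∧ F c b)) := by
  intro m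
  induction m with
  | zero => intro a c h; omega
  | succ m ih =>
    intro a c hm hFca hKca
    obtain ⟨b, hab, hbc, ⟨hb, hFb⟩ | ⟨hb, hFb⟩⟩ := hex a c hFca hKca
    · induction b using WellFoundedLT.induction with
      | ind b ihb =>
        -- If `K c b`, then `K b a` fails and the shorter pair `(a, b)` has a two-sided witness
        -- `b'`. Either `b'` is a smaller one-sided witness for `(a, c)`, or `F c b'` follows
        -- through `b` and `b'` is the answer. The other case is dual, moving upwards.
        by_cases hcb : K c b
        · obtain ⟨b', hab', hb'b, ⟨hb', hF₁, hK₁⟩ | ⟨hb', hK₁, hF₁⟩⟩ :=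
            ih a b (by omega) hFb (fun h => hKca (hK _ _ _ hcb h))
          · exact ihb b' hb'b hab' (hb'b.trans hbc) hb' hF₁
          · exact ⟨b', hab', hb'b.trans hbc, Or.inr ⟨hb', hK₁, hF _ _ _ (hKF _ _ hcb) hF₁⟩⟩
        · exact ⟨b, hab, hbc, Or.inl ⟨hb, hFb, hcb⟩⟩
    · induction b using WellFoundedGT.induction with
      | ind b ihb =>
        by_cases hba : K b a
        · obtain ⟨b', hbb', hb'c, ⟨hb', hF₁, hK₁⟩ | ⟨hb', hK₁, hF₁⟩⟩ :=
            ih b c (by omega) hFb (fun h => hKca (hK _ _ _ h hba))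
          · exact ⟨b', hab.trans hbb', hb'c, Or.inl ⟨hb', hF _ _ _ hF₁ (hKF _ _ hba), hK₁⟩⟩
          · exact ihb b' hbb' (hab.trans hbb') hb'c hb' hF₁
        · exact ⟨b, hab, hbc, Or.inr ⟨hb, hba, hFb⟩⟩

/-- `hex` asks only for one-sided witnesses, which is what chains provide; `exists_separating`
improves them. -/
theorem IRel.isPermutreePoset_ofPair {n : ℕ} {δ : PermutreeOrientation n}
    {K F : Fin n → Fin n → Prop} (h : IsIntervalPoset (IRel.ofPair K F))
    (hKF : ∀ u v, K u v → F u v)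
    (hK : ∀ a b c, K c b → K b a → K c a) (hF : ∀ a b c, F c b → F b a → F c a)
    (hKpos : ∀ a b c, a < b → b < c → b ∈ δ.pos → K c a → K c b)
    (hKneg : ∀ a b c, a < b → b < c → b ∈ δ.neg → K c a → K b a)
    (hFpos : ∀ a b c, a < b → b < c → b ∈ δ.pos → F b a → F c a)
    (hFneg : ∀ a b c, a < b → b < c → b ∈ δ.neg → F c b → F c a)
    (hex : ∀ a c, F c a → ¬ K c a → ∃ b, a < b ∧ b < c ∧
      ((b ∈ δ.pos ∧ F b a) ∨ (b ∈ δ.neg ∧ F c b))) :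
    IsPermutreePoset δ (IRel.ofPair K F) where
  toIsIntervalPoset := h
  pos := by
    rintro a b c (⟨hab, hbc⟩ | ⟨hab, hbc⟩) hb
    · rw [ofPair_inc hab, ofPair_inc (hab.trans hbc)]
      exact mt (hFpos a b c hab hbc hb)
    · rw [ofPair_dec hbc, ofPair_dec (hab.trans hbc)]
      exact hKpos c b a hab hbc hb
  neg := by
    rintro a b c (⟨hab, hbc⟩ | ⟨hab, hbc⟩) hb
    · rw [ofPair_inc hbc, ofPair_inc (hab.trans hbc)]
      exact mt (hFneg a b c hab hbc hb)
    · rw [ofPair_dec hab, ofPair_dec (hab.trans hbc)]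
      exact hKneg c b a hab hbc hb
  incomparable a c hac h₁ h₂ := by
    rw [ofPair_inc hac, not_not] at h₁
    rw [ofPair_dec hac] at h₂
    obtain ⟨b, hab, hbc, H⟩ := exists_separating hKF hK hF hex _ a c (Nat.lt_succ_self _) h₁ h₂
    refine ⟨b, hab, hbc, ?_⟩
    rw [ofPair_inc hab, ofPair_inc hbc, ofPair_dec hab, ofPair_dec hbc]
    simpa using H

/-! ### The join of two interval posets -/

section Join

open Relation

variable {n : ℕ}

/-- The strict decreasing pairs of `R` and of `S`. -/
def joinDec (R S : IRel n) (u v : Fin n) : Prop := v < u ∧ (R.rel u v ∨ S.rel u v)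

/-- The strict decreasing pairs whose reversal is missing from `R` or from `S`. -/
def joinCoInc (R S : IRel n) (u v : Fin n) : Prop := v < u ∧ (¬ R.rel v u ∨ ¬ S.rel v u)

/-- The join of two interval posets. -/
def joinRel (R S : IRel n) : IRel n :=
  IRel.ofPair (TransGen (joinDec R S)) (TransGen (joinCoInc R S))

variable {R S : IRel n}

theorem joinDec_lt : ∀ u v, joinDec R S u v → v < u := fun _ _ h => h.1

theorem joinCoInc_lt : ∀ u v, joinCoInc R S u v → v < u := fun _ _ h => h.1

theorem joinCoInc_of_joinDec (hR : IsIntervalPoset R) (hS : IsIntervalPoset S) {u v : Fin n}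
    (h : joinDec R S u v) : joinCoInc R S u v :=
  ⟨h.1, h.2.imp (fun h' h'' => h.1.ne (hR.antisymm _ _ h'' h'))
    (fun h' h'' => h.1.ne (hS.antisymm _ _ h'' h'))⟩

/-- The closures are transitive by construction. Single steps split, by `split` of `R` and `S` for
`joinDec` and by their transitivity for `joinCoInc`, and `transGen_cotrans` carries this to chains.
-/
theorem isIntervalPoset_joinRel (hR : IsIntervalPoset R) (hS : IsIntervalPoset S) :
    IsIntervalPoset (joinRel R S) := by
  apply IRel.isIntervalPoset_ofPair
  · exact fun u v => TransGen.mono (fun _ _ => joinCoInc_of_joinDec hR hS) u v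
  · exact fun a b c _ _ h₁ h₂ => h₁.trans h₂
  · refine fun a b c hab hbc h => transGen_cotrans ?_ h b hab hbc
    intro a b c hab hbc h
    have h₁ := hR.split c b a (Or.inr ⟨hab, hbc⟩)
    have h₂ := hS.split c b a (Or.inr ⟨hab, hbc⟩)
    simp only [joinDec, hab, hbc, hab.trans hbc, true_and] at h ⊢
    tauto
  · exact fun a b c _ _ h₁ h₂ => h₁.trans h₂
  · refine fun a b c hab hbc h => transGen_cotrans ?_ h b hab hbc
    intro a b c hab hbc h
    have h₁ := hR.trans a b c
    have h₂ := hS.trans a b c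
    simp only [joinCoInc, hab, hbc, hab.trans hbc, true_and] at h ⊢
    tauto

theorem le_joinRel_left : R ≤ joinRel R S := by
  rw [IRel.le_iff]
  intro a b hab
  rw [joinRel, IRel.ofPair_inc hab, IRel.ofPair_dec hab]
  refine ⟨fun h => ?_, fun h => TransGen.single ⟨hab, Or.inl h⟩⟩
  by_contra h'
  exact h (TransGen.single ⟨hab, Or.inl h'⟩)

theorem le_joinRel_right : S ≤ joinRel R S := by
  rw [IRel.le_iff]
  intro a b hab
  rw [joinRel, IRel.ofPair_inc hab, IRel.ofPair_dec hab]
  refine ⟨fun h => ?_, fun h => TransGen.single ⟨hab, Or.inr h⟩⟩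
  by_contra h'
  exact h (TransGen.single ⟨hab, Or.inr h'⟩)

theorem joinRel_le {Z : IRel n} (hZ : IsIntervalPoset Z) (hR : R ≤ Z) (hS : S ≤ Z) :
    joinRel R S ≤ Z := by
  rw [IRel.le_iff] at hR hS ⊢
  intro a b hab
  rw [joinRel, IRel.ofPair_inc hab, IRel.ofPair_dec hab]
  constructor
  · intro h h'
    -- By `split`, the missing increasing pairs of `Z` are closed under composition.
    have key : ∀ v, TransGen (joinCoInc R S) b v → ¬ Z.rel v b := by
      intro v hv
      induction hv with
      | single h =>
        have h₁ := (hR _ _ h.1).1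
        have h₂ := (hS _ _ h.1).1
        have h₃ := h.2
        tauto
      | @tail x v hbx hxv ih =>
        intro hvb
        have hx := transGen_lt joinCoInc_lt hbx
        rcases hZ.split v x b (Or.inl ⟨hxv.1, hx⟩) hvb with h | h
        · have h₁ := (hR _ _ hxv.1).1 h
          have h₂ := (hS _ _ hxv.1).1 h
          have h₃ := hxv.2
          tauto
        · exact ih h
    exact key a h' h
  · intro h
    induction h with
    | single h => exact h.2.elim (hR _ _ h.1).2 (hS _ _ h.1).2
    | tail hbx hxv ih =>
      exact hZ.trans _ _ _ (ih (transGen_lt joinDec_lt hbx))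
        (hxv.2.elim (hR _ _ hxv.1).2 (hS _ _ hxv.1).2)

theorem isPermutreePoset_joinRel {δ : PermutreeOrientation n} (hR : IsPermutreePoset δ R)
    (hS : IsPermutreePoset δ S) : IsPermutreePoset δ (joinRel R S) := by
  apply IRel.isPermutreePoset_ofPair
    (isIntervalPoset_joinRel hR.toIsIntervalPoset hS.toIsIntervalPoset)
  · exact fun u v => TransGen.mono
      (fun _ _ => joinCoInc_of_joinDec hR.toIsIntervalPoset hS.toIsIntervalPoset) u v
  · exact fun a b c h₁ h₂ => h₁.trans h₂
  · exact fun a b c h₁ h₂ => h₁.trans h₂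
  · refine fun a b c hab hbc hb h => transGen_left (p := (· ∈ δ.pos)) ?_ h b hab hbc hb
    exact fun a b c hab hbc hb h => ⟨hbc, h.2.imp (hR.pos c b a (Or.inr ⟨hab, hbc⟩) hb)
      (hS.pos c b a (Or.inr ⟨hab, hbc⟩) hb)⟩
  · refine fun a b c hab hbc hb h => transGen_right (p := (· ∈ δ.neg)) ?_ h b hab hbc hb
    exact fun a b c hab hbc hb h => ⟨hab, h.2.imp (hR.neg c b a (Or.inr ⟨hab, hbc⟩) hb)
      (hS.neg c b a (Or.inr ⟨hab, hbc⟩) hb)⟩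
  · refine fun a b c hab hbc hb h =>
      transGen_extend_right joinCoInc_lt (p := (· ∈ δ.pos)) ?_ h hb hbc
    exact fun a b c hab hbc hb h => ⟨hab.trans hbc,
      h.2.imp (mt (hR.pos a b c (Or.inl ⟨hab, hbc⟩) hb))
        (mt (hS.pos a b c (Or.inl ⟨hab, hbc⟩) hb))⟩
  · refine fun a b c hab hbc hb h =>
      transGen_extend_left joinCoInc_lt (p := (· ∈ δ.neg)) ?_ h hb hab
    exact fun a b c hab hbc hb h => ⟨hab.trans hbc,
      h.2.imp (mt (hR.neg a b c (Or.inl ⟨hab, hbc⟩) hb))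
        (mt (hS.neg a b c (Or.inl ⟨hab, hbc⟩) hb))⟩
  -- An increasing pair missing from `R` is either reversed in `R` or incomparable there. The
  -- incomparability witness yields missing pairs of `R`, hence of the join; its non-relations in
  -- decreasing direction say nothing about `S`, so the witness is one-sided.
  · have step : ∀ x y, joinCoInc R S x y → joinDec R S x y ∨ ∃ b, y < b ∧ b < x ∧
        ((b ∈ δ.pos ∧ joinCoInc R S b y) ∨ (b ∈ δ.neg ∧ joinCoInc R S x b)) := by
      rintro x y ⟨hyx, h | h⟩
      · by_cases hxy : R.rel x y
        · exact Or.inl ⟨hyx, Or.inl hxy⟩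
        · obtain ⟨b, hyb, hbx, H⟩ := hR.incomparable y x hyx h hxy
          exact Or.inr ⟨b, hyb, hbx, H.imp (fun H => ⟨H.1, hyb, Or.inl H.2.1⟩)
            (fun H => ⟨H.1, hbx, Or.inl H.2.2⟩)⟩
      · by_cases hxy : S.rel x y
        · exact Or.inl ⟨hyx, Or.inr hxy⟩
        · obtain ⟨b, hyb, hbx, H⟩ := hS.incomparable y x hyx h hxy
          exact Or.inr ⟨b, hyb, hbx, H.imp (fun H => ⟨H.1, hyb, Or.inr H.2.1⟩)
            (fun H => ⟨H.1, hbx, Or.inr H.2.2⟩)⟩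
    intro a c h
    induction h with
    | single h =>
      intro h'
      rcases step _ _ h with hd | ⟨b, h₁, h₂, H⟩
      · exact absurd (TransGen.single hd) h'
      · exact ⟨b, h₁, h₂, H.imp (And.imp_right TransGen.single) (And.imp_right TransGen.single)⟩
    | @tail x a hcx hxa ih =>
      intro h'
      have hx := transGen_lt joinCoInc_lt hcx
      -- If the last step is in `joinDec`, the rest of the chain is outside the closure of
      -- `joinDec`, and the witness for `(x, c)` serves. Otherwise the witness for the last step
      -- serves.
      rcases step _ _ hxa with hd | ⟨b, h₁, h₂, H⟩
      · obtain ⟨b, h₁, h₂, H⟩ := ih fun h => h' (h.tail hd)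
        exact ⟨b, hxa.1.trans h₁, h₂, H.imp_left (And.imp_right fun h => h.tail hxa)⟩
      · exact ⟨b, h₁, h₂.trans hx, H.imp (And.imp_right TransGen.single)
          (And.imp_right fun h => hcx.tail h)⟩

end Join

/-! ### Subtrees hanging at a vertex -/

section Hanging

variable {n : ℕ} {G : SimpleGraph (Fin n)} {m w u u' : Fin n}

theorem mem_hangingSubtree_self : w ∈ hangingSubtree G m w :=
  SimpleGraph.Reachable.refl (G := G.deleteEdges {s(m, w)}) w

theorem mem_hangingSubtree_of_adj (hu : u ∈ hangingSubtree G m w) (h : G.Adj u u')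
    (hne : s(u, u') ≠ s(m, w)) : u' ∈ hangingSubtree G m w :=
  SimpleGraph.Reachable.trans (G := G.deleteEdges {s(m, w)}) hu
    (SimpleGraph.Adj.reachable
      (by simpa [SimpleGraph.deleteEdges_adj] using ⟨h, by simpa using hne⟩))

theorem eq_of_crossing_hangingSubtree (hu : u ∈ hangingSubtree G m w)
    (hu' : u' ∉ hangingSubtree G m w) (h : G.Adj u u') : u = w ∧ u' = m := by
  by_contra hne
  refine hu' (mem_hangingSubtree_of_adj hu h fun he => ?_)
  rw [Sym2.eq_iff] at he
  rcases he with ⟨rfl, rfl⟩ | he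
  · exact hu' mem_hangingSubtree_self
  · exact hne he

theorem notMem_hangingSubtree (hG : G.IsTree) (h : G.Adj m w) : m ∉ hangingSubtree G m w :=
  fun hm => SimpleGraph.isAcyclic_iff_forall_adj_isBridge.1 hG.isAcyclic h hm.symm

end Hanging

/-! ### Permutrees satisfy the local conditions -/

namespace Permutree

variable {n : ℕ} {δ : PermutreeOrientation n}

theorem fromRel_flip (r : Fin n → Fin n → Prop) :
    SimpleGraph.fromRel (fun u v => r v u) = SimpleGraph.fromRel r := by
  ext u v
  simp [or_comm]

/-- The permutree obtained by reversing all the edges. -/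
def op (T : Permutree δ) : Permutree δ.op where
  edge u v := T.edge v u
  asymm u v h := T.asymm v u h
  isTree := by rw [fromRel_flip]; exact T.isTree
  one_parent := T.one_child
  one_child := T.one_parent
  two_parents := T.two_children
  two_children := T.two_parents
  ancestor_subtrees := by
    rw [fromRel_flip]
    exact T.descendant_subtrees
  descendant_subtrees := by
    rw [fromRel_flip]
    exact T.ancestor_subtrees

theorem toIRel_op (T : Permutree δ) : T.op.toIRel = T.toIRel.op := by
  ext u v
  exact Relation.reflTransGen_swap

theorem op_mem_PEP {R : IRel n} (h : R ∈ PEP δ) : R.op ∈ PEP δ.op := by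
  obtain ⟨T, rfl⟩ := h
  exact ⟨T.op, T.toIRel_op⟩

variable (T : Permutree δ)

/-- The underlying graph. -/
abbrev graph : SimpleGraph (Fin n) := SimpleGraph.fromRel T.edge

/-- The subtree hanging at `m` through `w`. -/
abbrev hanging (m w : Fin n) : Set (Fin n) := hangingSubtree T.graph m w

variable {T} {m w w' u v x y b : Fin n}

theorem edge_ne (h : T.edge u v) : u ≠ v := by
  rintro rfl
  exact T.asymm u u h h

theorem adj_of_edge (h : T.edge u v) : T.graph.Adj u v :=
  (SimpleGraph.fromRel_adj _ _ _).2 ⟨edge_ne h, Or.inl h⟩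

/-- The edge between `m` and `w` is the only way out of the subtree, so a directed path that leaves
must traverse it and fixes its direction. `enter_hanging` is the same for paths going in. -/
theorem exit_hanging (h : T.toIRel.rel x y) (hx : x ∈ T.hanging m w) (hy : y ∉ T.hanging m w) :
    T.edge w m ∧ T.toIRel.rel x w ∧ T.toIRel.rel m y := by
  induction h using Relation.ReflTransGen.head_induction_on with
  | refl => exact absurd hx hy
  | @head x z hxz hzy ih =>
    by_cases hz : z ∈ T.hanging m w
    · obtain ⟨h₁, h₂, h₃⟩ := ih hz
      exact ⟨h₁, h₂.head hxz, h₃⟩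
    · obtain ⟨rfl, rfl⟩ := eq_of_crossing_hangingSubtree hx hz (adj_of_edge hxz)
      exact ⟨hxz, Relation.ReflTransGen.refl, hzy⟩

theorem enter_hanging (h : T.toIRel.rel x y) (hx : x ∉ T.hanging m w) (hy : y ∈ T.hanging m w) :
    T.edge m w ∧ T.toIRel.rel x m ∧ T.toIRel.rel w y := by
  induction h using Relation.ReflTransGen.head_induction_on with
  | refl => exact absurd hy hx
  | @head x z hxz hzy ih =>
    by_cases hz : z ∈ T.hanging m w
    · obtain ⟨rfl, rfl⟩ := eq_of_crossing_hangingSubtree hz hx (adj_of_edge hxz).symm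
      exact ⟨hxz, Relation.ReflTransGen.refl, hzy⟩
    · obtain ⟨h₁, h₂, h₃⟩ := ih hz
      exact ⟨h₁, h₂.head hxz, h₃⟩

theorem notMem_hanging (h : T.graph.Adj m w) : m ∉ T.hanging m w :=
  notMem_hangingSubtree T.isTree h

theorem not_rel_of_edge (h : T.edge u v) : ¬ T.toIRel.rel v u := fun h' =>
  T.asymm u v h (exit_hanging h' mem_hangingSubtree_self (notMem_hanging (adj_of_edge h))).1

theorem rel_antisymm (h : T.toIRel.rel u v) (h' : T.toIRel.rel v u) : u = v := by
  rcases Relation.ReflTransGen.cases_head h with h | ⟨w, huw, hwv⟩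
  · exact h
  · exact absurd (Relation.ReflTransGen.trans hwv h') (not_rel_of_edge huw)

/-- The path from `b` to `u` goes up to `m` through `w` and then goes down through `w'`. -/
structure TurnDown (T : Permutree δ) (b u m w w' : Fin n) : Prop where
  ne : w ≠ w'
  edge₁ : T.edge w m
  edge₂ : T.edge w' m
  rel : T.toIRel.rel b w
  mem₁ : b ∈ T.hanging m w
  mem₂ : u ∈ T.hanging m w'

/-- The path from `b` to `u` arrives through some child `w` of `u`; going down to `v` is
backtracking if `w = v` and a turn at `u` otherwise. -/
theorem exists_turn_of_edge_down (hbu : T.toIRel.rel b u) (h : T.edge v u) :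
    T.toIRel.rel b v ∨ T.toIRel.rel v b ∨ ∃ m w w', TurnDown T b v m w w' := by
  rcases Relation.ReflTransGen.cases_tail hbu with rfl | ⟨w, hbw, hwu⟩
  · exact Or.inr (Or.inl (Relation.ReflTransGen.single h))
  · by_cases hwv : w = v
    · exact Or.inl (hwv ▸ hbw)
    · refine Or.inr (Or.inr ⟨u, w, v, hwv, hwu, h, hbw, ?_, mem_hangingSubtree_self⟩)
      by_contra hb
      exact T.asymm _ _ hwu (enter_hanging hbw hb mem_hangingSubtree_self).1

theorem TurnDown.step (h : TurnDown T b u m w w') (huv : T.graph.Adj u v) :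
    T.toIRel.rel b v ∨ TurnDown T b v m w w' := by
  by_cases hv : v ∈ T.hanging m w'
  · exact Or.inr { h with mem₂ := hv }
  · obtain ⟨_, rfl⟩ := eq_of_crossing_hangingSubtree h.mem₂ hv huv
    exact Or.inl (h.rel.tail h.edge₁)

/-- Of the tree path from `b` to `u`, only the first turn is remembered. A later step keeps it, or
leads back to the turning vertex, which is comparable to `b`. -/
theorem rel_or_turn (T : Permutree δ) (b u : Fin n) :
    T.toIRel.rel b u ∨ T.toIRel.rel u b ∨ (∃ m w w', TurnDown T b u m w w') ∨
      ∃ m w w', TurnDown T.op b u m w w' := by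
  have hreach := T.isTree.connected.preconnected b u
  rw [SimpleGraph.reachable_iff_reflTransGen] at hreach
  induction hreach with
  | refl => exact Or.inl Relation.ReflTransGen.refl
  | @tail u v _ huv ih =>
    have hop : ∀ {x y}, T.op.toIRel.rel x y ↔ T.toIRel.rel y x := by
      intro x y
      rw [toIRel_op, IRel.op_rel]
    have hadj : T.op.graph.Adj u v := by
      have : T.op.graph = T.graph := fromRel_flip T.edge
      rwa [this]
    rcases ih with h | h | ⟨m, w, w', h⟩ | ⟨m, w, w', h⟩
    · rcases ((SimpleGraph.fromRel_adj _ _ _).1 huv).2 with he | he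
      · exact Or.inl (h.tail he)
      · exact (exists_turn_of_edge_down h he).imp_right (Or.imp_right Or.inl)
    · rcases ((SimpleGraph.fromRel_adj _ _ _).1 huv).2 with he | he
      · have := exists_turn_of_edge_down (T := T.op) (hop.2 h) he
        rw [hop, hop] at this
        rcases this with h | h | h
        · exact Or.inr (Or.inl h)
        · exact Or.inl h
        · exact Or.inr (Or.inr (Or.inr h))
      · exact Or.inr (Or.inl (h.head he))
    · rcases h.step huv with h | h
      · exact Or.inl h
      · exact Or.inr (Or.inr (Or.inl ⟨m, w, w', h⟩))
    · rcases h.step hadj with h | h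
      · exact Or.inr (Or.inl (hop.1 h))
      · exact Or.inr (Or.inr (Or.inr ⟨m, w, w', h⟩))

theorem TurnDown.mem_neg (h : TurnDown T b u m w w') : m ∈ δ.neg := by
  by_contra hm
  exact h.ne (T.one_child m hm w w' h.edge₁ h.edge₂)

/-- The value of the turning point separates the two sides of the turn. -/
theorem TurnDown.separates (h : TurnDown T b u m w w') :
    (∀ x ∈ T.hanging m w, ∀ y ∈ T.hanging m w', x < m ∧ m < y) ∨
      (∀ x ∈ T.hanging m w, ∀ y ∈ T.hanging m w', m < x ∧ y < m) := by
  have key := T.two_children m h.mem_neg w w' h.edge₁ h.edge₂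
  have hw : w ∈ T.hanging m w := mem_hangingSubtree_self
  have hw' : w' ∈ T.hanging m w' := mem_hangingSubtree_self
  rcases T.descendant_subtrees m h.mem_neg w h.edge₁ with h₁ | h₁ <;>
    rcases T.descendant_subtrees m h.mem_neg w' h.edge₂ with h₂ | h₂
  · exact absurd (key (iff_of_true (h₁ w hw) (h₂ w' hw'))) h.ne
  · exact Or.inl fun x hx y hy => ⟨h₁ x hx, h₂ y hy⟩
  · exact Or.inr fun x hx y hy => ⟨h₁ x hx, h₂ y hy⟩
  · exact absurd (key (iff_of_false (h₁ w hw).not_gt (h₂ w' hw').not_gt)) h.ne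

/-- If the path from `b` to `x` turns down at `m`, then `m` separates `b` from the subtree
containing `x`. As `b` lies between `x` and `y`, the path to `y` must leave that subtree through
`m`, which is above `b`. If it turns up, the path from `x` cannot leave its subtree, so `y` is on
the wrong side of `m`. -/
theorem rel_split (hb : StrictlyBetween x b y) (h : T.toIRel.rel x y) :
    T.toIRel.rel x b ∨ T.toIRel.rel b y := by
  rcases rel_or_turn T b x with h' | h' | ⟨m, w, w', ht⟩ | ⟨m, w, w', ht⟩
  · exact Or.inr (Relation.ReflTransGen.trans h' h)
  · exact Or.inl h'
  · right
    by_cases hy : y ∈ T.hanging m w'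
    · exfalso
      rcases ht.separates with hs | hs <;> have h₁ := hs b ht.mem₁ x ht.mem₂ <;>
        have h₂ := hs b ht.mem₁ y hy <;> unfold StrictlyBetween at hb <;> omega
    · exact Relation.ReflTransGen.trans (ht.rel.tail ht.edge₁) (exit_hanging h ht.mem₂ hy).2.2
  · exfalso
    have hG : T.op.graph = T.graph := fromRel_flip T.edge
    by_cases hy : y ∈ T.op.hanging m w'
    · rcases ht.separates with hs | hs <;> have h₁ := hs b ht.mem₁ x ht.mem₂ <;>
        have h₂ := hs b ht.mem₁ y hy <;> unfold StrictlyBetween at hb <;> omega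
    · have hx := ht.mem₂
      unfold hanging at hx hy
      rw [hG] at hx hy
      exact T.asymm _ _ (exit_hanging h hx hy).1 ht.edge₂

/-- If `b` is below `y`, then `y` is in an ancestor subtree of `b`. All its labels are on one side
of `b`, so `x` is outside, and the path from `x` to `y` enters through `b`. -/
theorem rel_pos (hb : StrictlyBetween x b y) (hδ : b ∈ δ.pos) (h : T.toIRel.rel x y) :
    T.toIRel.rel x b := by
  rcases rel_split hb h with h' | h'
  · exact h'
  · rcases Relation.ReflTransGen.cases_head h' with rfl | ⟨w, hbw, hwy⟩
    · unfold StrictlyBetween at hb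
      omega
    · have hy : y ∈ T.hanging b w := by
        by_contra hy
        exact T.asymm _ _ hbw (exit_hanging hwy mem_hangingSubtree_self hy).1
      by_cases hx : x ∈ T.hanging b w
      · exfalso
        rcases T.ancestor_subtrees b hδ w hbw with hs | hs <;> have h₁ := hs x hx <;>
          have h₂ := hs y hy <;> unfold StrictlyBetween at hb <;> omega
      · exact (enter_hanging h hx hy).2.1

theorem TurnDown.not_rel (h : TurnDown T b u m w w') :
    ¬ T.toIRel.rel m b ∧ ¬ T.toIRel.rel m u :=
  ⟨fun h' => T.asymm _ _ h.edge₁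
      (enter_hanging h' (notMem_hanging (adj_of_edge h.edge₁).symm) h.mem₁).1,
    fun h' => T.asymm _ _ h.edge₂
      (enter_hanging h' (notMem_hanging (adj_of_edge h.edge₂).symm) h.mem₂).1⟩

theorem TurnDown.between (h : TurnDown T b u m w w') (hbu : b < u) : b < m ∧ m < u := by
  rcases h.separates with hs | hs <;> have h₁ := hs b h.mem₁ u h.mem₂ <;> omega

theorem isPermutreePoset (T : Permutree δ) : IsPermutreePoset δ T.toIRel where
  antisymm _ _ := rel_antisymm
  trans _ _ _ := Relation.ReflTransGen.trans
  split _ _ _ := rel_split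
  pos _ _ _ := rel_pos
  neg a b c hb hδ h := by
    have := rel_pos (T := T.op) hb.symm hδ (x := c) (y := a)
    rw [toIRel_op] at this
    exact this h
  incomparable a c hac h₁ h₂ := by
    rcases rel_or_turn T a c with h | h | ⟨m, w, w', h⟩ | ⟨m, w, w', h⟩
    · exact absurd h h₁
    · exact absurd h h₂
    · exact ⟨m, (h.between hac).1, (h.between hac).2, Or.inr ⟨h.mem_neg, h.not_rel⟩⟩
    · have := h.not_rel
      rw [toIRel_op] at this
      exact ⟨m, (h.between hac).1, (h.between hac).2, Or.inl ⟨h.mem_neg, this⟩⟩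

end Permutree

/-! ### Hasse diagrams of permutree posets are permutrees -/

/-- `l` is the nearest wall at or below `p`, or the minimum if there is none; the guard `u < l`
makes the wall clause vacuous for the minimum. -/
theorem exists_lower_wall {α : Type*} [LinearOrder α] [Finite α] (wall : α → Prop) (p : α) :
    ∃ l, l ≤ p ∧ (∀ u, u < l → wall l) ∧ ∀ b, l < b → b ≤ p → ¬ wall b := by
  by_cases hS : ({b | b ≤ p ∧ wall b} : Set α).Nonempty
  · obtain ⟨l, hl, hmax⟩ := (wellFounded_gt (α := α)).has_min _ hS
    exact ⟨l, hl.1, fun _ _ => hl.2, fun b hb hbp hw => hmax b ⟨hbp, hw⟩ hb⟩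
  · obtain ⟨l, hl, hmin⟩ := (wellFounded_lt (α := α)).has_min {b | b ≤ p} ⟨p, le_rfl⟩
    exact ⟨l, hl, fun u hu => absurd hu (hmin u (hu.le.trans hl)),
      fun b _ hbp hw => hS ⟨b, hbp, hw⟩⟩

theorem exists_upper_wall {α : Type*} [LinearOrder α] [Finite α] (wall : α → Prop) (q : α) :
    ∃ r, q ≤ r ∧ (∀ u, r < u → wall r) ∧ ∀ b, b < r → q ≤ b → ¬ wall b :=
  exists_lower_wall (α := αᵒᵈ) wall q

namespace IRel

variable {n : ℕ}

/-- The cover relation of `R`. -/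
def Cover (R : IRel n) (u v : Fin n) : Prop :=
  R.rel u v ∧ u ≠ v ∧ ∀ z, R.rel u z → R.rel z v → z = u ∨ z = v

theorem Cover.op {R : IRel n} {u v : Fin n} (h : R.Cover u v) : R.op.Cover v u :=
  ⟨h.1, h.2.1.symm, fun z h₁ h₂ => (h.2.2 z h₂ h₁).symm⟩

theorem Cover.eq_of_rel {R : IRel n} {v w w' : Fin n} (hw : R.Cover v w)
    (hw' : R.Cover v w') (hrel : R.rel w w') : w = w' :=
  (hw'.2.2 w hw.1 hrel).resolve_left hw.2.1.symm

end IRel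

namespace IsIntervalPoset

variable {n : ℕ} {R : IRel n}

theorem wellFounded (h : IsIntervalPoset R) : WellFounded fun u v => R.rel u v ∧ u ≠ v := by
  have : IsTrans (Fin n) fun u v => R.rel u v ∧ u ≠ v := ⟨by
    rintro u v w ⟨h₁, h₂⟩ ⟨h₃, h₄⟩
    refine ⟨h.trans _ _ _ h₁ h₃, ?_⟩
    rintro rfl
    exact h₂ (h.antisymm _ _ h₁ h₃)⟩
  have : Std.Irrefl fun u v => R.rel u v ∧ u ≠ v := ⟨fun u hu => hu.2 rfl⟩
  exact Finite.wellFounded_of_trans_of_irrefl _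

theorem exists_cover (h : IsIntervalPoset R) {u v : Fin n} (huv : R.rel u v) (hne : u ≠ v) :
    ∃ w, R.Cover u w ∧ R.rel w v := by
  obtain ⟨w, ⟨h₁, h₂, h₃⟩, hmin⟩ := h.wellFounded.has_min
    {w | R.rel u w ∧ u ≠ w ∧ R.rel w v} ⟨v, huv, hne, R.refl v⟩
  refine ⟨w, ⟨h₁, h₂, fun z hz hz' => ?_⟩, h₃⟩
  by_contra! H
  exact hmin z ⟨hz, H.1.symm, h.trans _ _ _ hz' h₃⟩ ⟨hz', H.2⟩

theorem reflTransGen_cover (h : IsIntervalPoset R) {u v : Fin n} :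
    Relation.ReflTransGen R.Cover u v ↔ R.rel u v := by
  constructor
  · intro H
    induction H with
    | refl => exact R.refl _
    | tail _ h₂ ih => exact h.trans _ _ _ ih h₂.1
  · induction u using h.op.wellFounded.induction with
    | _ u ih =>
      intro huv
      by_cases hne : u = v
      · exact hne ▸ Relation.ReflTransGen.refl
      · obtain ⟨w, hw, hwv⟩ := h.exists_cover huv hne
        exact (ih w ⟨hw.1, hw.2.1.symm⟩ hwv).head hw

end IsIntervalPoset

namespace IsPermutreePoset

variable {n : ℕ} {δ : PermutreeOrientation n} {R : IRel n}

/-- Distinct covers of `v` are incomparable, hence have a witness `b` between them. If `b ≠ v`, then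
`b` is in `δ⁺` and above `v`. A cover `x` of `v` below `b` lies strictly between `w` and `w'` by
`split`, and induction on both halves yields `v < x` and `x < v`. -/
theorem between_parents_aux (h : IsPermutreePoset δ R) {v : Fin n} :
    ∀ (m : ℕ) (w w' : Fin n), w'.val - w.val < m → R.Cover v w → R.Cover v w' → w < w' →
      v ∈ δ.pos ∧ w < v ∧ v < w' := by
  intro m
  induction m with
  | zero => intro w w' h; omega
  | succ m ih =>
    intro w w' hm hw hw' hlt
    have hi := h.toIsIntervalPoset
    obtain ⟨b, hwb, hbw', H⟩ := h.incomparable w w' hlt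
      (fun hr => hlt.ne (hw.eq_of_rel hw' hr))
      (fun hr => hlt.ne' (hw'.eq_of_rel hw hr))
    by_cases hbv : b = v
    · subst hbv
      rcases H with H | H
      · exact ⟨H.1, hwb, hbw'⟩
      · exact absurd hw.1 H.2.1
    obtain ⟨hb, hwb', hw'b'⟩ : b ∈ δ.pos ∧ ¬ R.rel w b ∧ ¬ R.rel w' b := by
      refine H.resolve_right ?_
      rintro ⟨hb, h₁, h₂⟩
      rcases lt_or_gt_of_ne hbv with hlt | hlt
      · exact h₁ (h.neg v b w (Or.inr ⟨hwb, hlt⟩) hb hw.1)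
      · exact h₂ (h.neg v b w' (Or.inl ⟨hlt, hbw'⟩) hb hw'.1)
    have hvb : R.rel v b := by
      rcases lt_or_gt_of_ne hbv with hlt | hlt
      · exact h.pos v b w (Or.inr ⟨hwb, hlt⟩) hb hw.1
      · exact h.pos v b w' (Or.inl ⟨hlt, hbw'⟩) hb hw'.1
    obtain ⟨x, hx, hxb⟩ := hi.exists_cover hvb (Ne.symm hbv)
    have hxw : x ≠ w := by rintro rfl; exact hwb' hxb
    have hxw' : x ≠ w' := by rintro rfl; exact hw'b' hxb
    have h₁ : w < x := by
      by_contra hlt'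
      rcases hi.split x w b (Or.inl ⟨lt_of_le_of_ne (not_lt.1 hlt') hxw, hwb⟩) hxb with h' | h'
      · exact hxw (hx.eq_of_rel hw h')
      · exact hwb' h'
    have h₂ : x < w' := by
      by_contra hlt'
      rcases hi.split x w' b (Or.inr ⟨hbw', lt_of_le_of_ne (not_lt.1 hlt') hxw'.symm⟩) hxb
        with h' | h'
      · exact hxw' (hx.eq_of_rel hw' h')
      · exact hw'b' h'
    have h₃ := ih w x (by omega) hw hx h₁
    have h₄ := ih x w' (by omega) hx hw' h₂
    exact absurd h₃.2.2 h₄.2.1.not_gt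

/-- Two distinct parents of `v` are on both sides of `v`, which is in `δ⁺`. -/
theorem between_parents (h : IsPermutreePoset δ R) {v w w' : Fin n} (hw : R.Cover v w)
    (hw' : R.Cover v w') (hlt : w < w') : v ∈ δ.pos ∧ w < v ∧ v < w' :=
  h.between_parents_aux _ w w' (Nat.lt_succ_self _) hw hw' hlt

theorem one_parent (h : IsPermutreePoset δ R) {v w w' : Fin n} (hv : v ∉ δ.pos)
    (hw : R.Cover v w) (hw' : R.Cover v w') : w = w' := by
  by_contra hne
  rcases lt_or_gt_of_ne hne with hlt | hlt
  · exact hv (h.between_parents hw hw' hlt).1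
  · exact hv (h.between_parents hw' hw hlt).1

theorem two_parents (h : IsPermutreePoset δ R) {v w w' : Fin n}
    (hw : R.Cover v w) (hw' : R.Cover v w') (hiff : w < v ↔ w' < v) : w = w' := by
  by_contra hne
  rcases lt_or_gt_of_ne hne with hlt | hlt
  · have := h.between_parents hw hw' hlt
    omega
  · have := h.between_parents hw' hw hlt
    omega

/-- Let `U` be a lower set. In an interval without interior walls for `U`, a maximal element of `U`
is above all elements of `U` and below all elements outside of `U`. -/
theorem comparable_of_maximal (h : IsPermutreePoset δ R) {U : Set (Fin n)}
    (hU : ∀ x y, R.rel x y → y ∈ U → x ∈ U) {l r : Fin n}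
    (hwall : ∀ b, l < b → b < r → (b ∈ δ.pos → b ∉ U) ∧ (b ∈ δ.neg → b ∈ U)) {x : Fin n}
    (hlx : l ≤ x) (hxr : x ≤ r) (hxU : x ∈ U)
    (hmax : ∀ z, l ≤ z → z ≤ r → z ∈ U → R.rel x z → z = x) :
    ∀ (m : ℕ) (y : Fin n), (y.val - x.val) + (x.val - y.val) < m → l ≤ y → y ≤ r →
      (y ∈ U → R.rel y x) ∧ (y ∉ U → R.rel x y) := by
  intro m
  induction m with
  | zero => intro y h; omega
  | succ m ih =>
    intro y hm hly hyr
    by_cases hyx : R.rel y x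
    · exact ⟨fun _ => hyx, fun hy => absurd (hU _ _ hyx hxU) hy⟩
    by_cases hxy : R.rel x y
    · refine ⟨fun hy => ?_, fun _ => hxy⟩
      rw [hmax y hly hyr hy hxy]
      exact R.refl x
    exfalso
    have hne : x ≠ y := by
      rintro rfl
      exact hxy (R.refl x)
    -- A witness for the pair `x`, `y` is closer to `x` than `y` is, so induction compares it with
    -- `x`. Not being a wall, it is on the side of `U` that contradicts the witness property.
    have key : ∀ b, StrictlyBetween x b y →
        ((b ∈ δ.pos ∧ ¬ R.rel x b) ∨ (b ∈ δ.neg ∧ ¬ R.rel b x)) → False := by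
      intro b hb H
      unfold StrictlyBetween at hb
      have h₁ := hwall b (by omega) (by omega)
      have h₂ := ih b (by omega) (by omega) (by omega)
      tauto
    rcases lt_or_gt_of_ne hne with hlt | hlt
    · obtain ⟨b, h₁, h₂, H⟩ := h.incomparable x y hlt hxy hyx
      exact key b (Or.inl ⟨h₁, h₂⟩) (by tauto)
    · obtain ⟨b, h₁, h₂, H⟩ := h.incomparable y x hlt hyx hxy
      exact key b (Or.inr ⟨h₁, h₂⟩) (by tauto)

/-- For a cover `v w`, there is a lower set `U` and an interval containing `v` and `w`, such that
the interval has no interior walls for `U` and is maximal, and such that `v` is the largest element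
of `U` and `w` is the smallest element outside of `U` in this interval. -/
theorem exists_strand (h : IsPermutreePoset δ R) {v w : Fin n} (hvw : R.Cover v w) :
    ∃ (U : Set (Fin n)) (l r : Fin n), v ∈ U ∧ w ∉ U ∧ (∀ x y, R.rel x y → y ∈ U → x ∈ U) ∧
      l ≤ min v w ∧ max v w ≤ r ∧
      (∀ b, l < b → b < r → (b ∈ δ.pos → b ∉ U) ∧ (b ∈ δ.neg → b ∈ U)) ∧
      (∀ u, u < l → (l ∈ δ.pos ∧ l ∈ U) ∨ (l ∈ δ.neg ∧ l ∉ U)) ∧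
      (∀ u, r < u → (r ∈ δ.pos ∧ r ∈ U) ∨ (r ∈ δ.neg ∧ r ∉ U)) ∧
      (∀ a, l ≤ a → a ≤ r → a ∈ U → R.rel a v) ∧ (∀ a, l ≤ a → a ≤ r → a ∉ U → R.rel w a) := by
  have hi := h.toIsIntervalPoset
  -- The lower set generated by `v` and the `δ⁻` values between `v` and `w`. These are below `w`, so
  -- the cover condition keeps `v` maximal in `U`.
  set U : Set (Fin n) :=
    {u | ∃ b, (b = v ∨ (StrictlyBetween v b w ∧ b ∈ δ.neg)) ∧ R.rel u b} with hUdef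
  have hlow : ∀ x y, R.rel x y → y ∈ U → x ∈ U := by
    rintro x y hxy ⟨b, hb, hyb⟩
    exact ⟨b, hb, hi.trans _ _ _ hxy hyb⟩
  have hvU : v ∈ U := ⟨v, Or.inl rfl, R.refl v⟩
  have hinterval : ∀ z, z ∈ U → R.rel v z → z = v := by
    rintro z ⟨b, rfl | ⟨hb, hbδ⟩, hzb⟩ hvz
    · exact hi.antisymm _ _ hzb hvz
    · have hbw := h.neg v b w hb hbδ hvw.1
      refine (hvw.2.2 z hvz (hi.trans _ _ _ hzb hbw)).resolve_right ?_
      rintro rfl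
      have := hi.antisymm _ _ hzb hbw
      unfold StrictlyBetween at hb
      omega
  have hwU : w ∉ U := fun hw => hvw.2.1 (hinterval w hw hvw.1).symm
  have hmid : ∀ b, StrictlyBetween v b w → (b ∈ δ.pos → b ∉ U) ∧ (b ∈ δ.neg → b ∈ U) := by
    refine fun b hb => ⟨fun hbδ hbU => ?_, fun hbδ => ⟨b, Or.inr ⟨hb, hbδ⟩, R.refl b⟩⟩
    have := hinterval b hbU (h.pos v b w hb hbδ hvw.1)
    unfold StrictlyBetween at hb
    omega
  obtain ⟨l, hl, hlwall, hlmax⟩ := exists_lower_wall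
    (fun b => (b ∈ δ.pos ∧ b ∈ U) ∨ (b ∈ δ.neg ∧ b ∉ U)) (min v w)
  obtain ⟨r, hr, hrwall, hrmin⟩ := exists_upper_wall
    (fun b => (b ∈ δ.pos ∧ b ∈ U) ∨ (b ∈ δ.neg ∧ b ∉ U)) (max v w)
  have hwall : ∀ b, l < b → b < r → (b ∈ δ.pos → b ∉ U) ∧ (b ∈ δ.neg → b ∈ U) := by
    intro b hlb hbr
    by_cases h₁ : b ≤ min v w
    · have := hlmax b hlb h₁
      tauto
    by_cases h₂ : max v w ≤ b
    · have := hrmin b hbr h₂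
      tauto
    refine hmid b ?_
    unfold StrictlyBetween
    rw [not_le, min_lt_iff] at h₁
    rw [not_le, lt_max_iff] at h₂
    omega
  have hbv := fun y => h.comparable_of_maximal hlow hwall (hl.trans (min_le_left _ _))
    ((le_max_left _ _).trans hr) hvU (fun z _ _ hz hvz => hinterval z hz hvz) _ y
    (Nat.lt_succ_self _)
  have hbw := fun y => h.op.comparable_of_maximal (U := Uᶜ) (l := l) (r := r) (x := w)
    (fun x y hxy hy hx => hy (hlow _ _ hxy hx))
    (fun b h₁ h₂ => ⟨fun hb hb' => hb' ((hwall b h₁ h₂).2 hb), (hwall b h₁ h₂).1⟩)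
    (hl.trans (min_le_right _ _)) ((le_max_right _ _).trans hr) hwU
    (fun z h₁ h₂ hz hzw => (hvw.2.2 z ((hbv z h₁ h₂).2 hz) hzw).resolve_left
      fun hzv => hz (hzv ▸ hvU)) _ y (Nat.lt_succ_self _)
  exact ⟨U, l, r, hvU, hwU, hlow, hl, hr, hwall, hlwall, hrwall, fun a h₁ h₂ => (hbv a h₁ h₂).1,
    fun a h₁ h₂ => (hbw a h₁ h₂).1⟩

/-- The removal of a cover `v w` cuts the Hasse diagram into two parts. -/
theorem exists_cut (h : IsPermutreePoset δ R) {v w : Fin n} (hvw : R.Cover v w) :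
    ∃ A : Set (Fin n), v ∈ A ∧ w ∉ A ∧
      (∀ x y, R.Cover x y → ¬ (x ∈ A ↔ y ∈ A) → x = v ∧ y = w) ∧
      (v ∈ δ.pos → (∀ u, u ∉ A → u < v) ∨ (∀ u, u ∉ A → v < u)) ∧
      (w ∈ δ.neg → (∀ u, u ∈ A → u < w) ∨ (∀ u, u ∈ A → w < u)) := by
  have hi := h.toIsIntervalPoset
  obtain ⟨U, l, r, hvU, hwU, hlow, hl, hr, hwall, hlwall, hrwall, hle, hge⟩ := h.exists_strand hvw
  rw [le_min_iff] at hl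
  rw [max_le_iff] at hr
  -- `f` clamps to `[l, r]`, and the cut is the preimage of `U` under `f`. A moved value lands on a
  -- wall.
  obtain ⟨f, hf⟩ : ∃ f : Fin n → Fin n, ∀ u,
      (f u = u ∧ l ≤ u ∧ u ≤ r) ∨ (u < l ∧ f u = l) ∨ (r < u ∧ f u = r) := by
    refine ⟨fun u => if u < l then l else if r < u then r else u, fun u => ?_⟩
    dsimp only
    split_ifs <;> omega
  have hfmem : ∀ u, l ≤ f u ∧ f u ≤ r := by
    intro u
    have := hf u
    omega
  have hfv : f v = v := by
    have := hf v
    omega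
  have hfw : f w = w := by
    have := hf w
    omega
  have hfwall : ∀ u, f u ≠ u → (f u ∈ δ.pos ∧ f u ∈ U) ∨ (f u ∈ δ.neg ∧ f u ∉ U) := by
    intro u hu
    rcases hf u with h' | ⟨h', h''⟩ | ⟨h', h''⟩
    · exact absurd h'.1 hu
    · rw [h'']
      exact hlwall u h'
    · rw [h'']
      exact hrwall u h'
  have hcross : ∀ x y, f x ≠ f y →
      (f x ≠ x → StrictlyBetween x (f x) y) ∧ (f y ≠ y → StrictlyBetween x (f y) y) ∧ x ≠ f y := by
    intro x y hxy
    have h₁ := hf x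
    have h₂ := hf y
    unfold StrictlyBetween
    omega
  have hle' : ∀ u, f u ∈ U → R.rel (f u) v := fun u => hle _ (hfmem u).1 (hfmem u).2
  have hge' : ∀ u, f u ∉ U → R.rel w (f u) := fun u => hge _ (hfmem u).1 (hfmem u).2
  refine ⟨{u | f u ∈ U}, by simpa [hfv], by simpa [hfw], ?_, ?_, ?_⟩
  · intro x y hxy hxyA
    replace hxyA : ¬ (f x ∈ U ↔ f y ∈ U) := hxyA
    have hne : f x ≠ f y := fun he => hxyA (he ▸ Iff.rfl)
    obtain ⟨hcx, hcy, hxfy⟩ := hcross x y hne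
    by_cases hx : f x ∈ U
    · have hy : f y ∉ U := by tauto
      -- A wall in `U` is in `δ⁺` and a wall outside is in `δ⁻`. Hence `x ⊲ f x ⊲ v ⊲ w ⊲ f y ⊲ y`,
      -- and the cover `x y` collapses to `v w`.
      have h₁ : R.rel x (f x) := by
        by_cases hfx : f x = x
        · rw [hfx]
          exact R.refl x
        · exact h.pos x _ y (hcx hfx) ((hfwall x hfx).resolve_right fun H => H.2 hx).1 hxy.1
      have h₂ : R.rel (f y) y := by
        by_cases hfy : f y = y
        · rw [hfy]
          exact R.refl y
        · exact h.neg x _ y (hcy hfy) ((hfwall y hfy).resolve_left fun H => hy H.2).1 hxy.1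
      have hxv := hi.trans _ _ _ h₁ (hle' x hx)
      have hwy := hi.trans _ _ _ (hge' y hy) h₂
      have hvx : v = x := by
        refine (hxy.2.2 v hxv (hi.trans _ _ _ hvw.1 hwy)).resolve_right ?_
        rintro rfl
        exact hvw.2.1 (hi.antisymm _ _ hvw.1 hwy)
      subst hvx
      exact ⟨rfl, ((hxy.2.2 w hvw.1 hwy).resolve_left hvw.2.1.symm).symm⟩
    -- In the other direction, `x ⊲ f y ⊲ v ⊲ w ⊲ f x ⊲ y`, so `f y` is `x` or `y`, and both are
    -- impossible.
    · exfalso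
      have hy : f y ∈ U := by tauto
      have hxfy' : R.rel x (f y) := by
        by_cases hfy : f y = y
        · rw [hfy]
          exact hxy.1
        · exact h.pos x _ y (hcy hfy) ((hfwall y hfy).resolve_right fun H => H.2 hy).1 hxy.1
      have hfx : f x ≠ x := fun hfx => hx (hfx.symm ▸ hlow _ _ hxfy' hy)
      have hfxy := h.neg x _ y (hcx hfx) ((hfwall x hfx).resolve_left fun H => hx H.2).1 hxy.1
      have hfyx : R.rel (f y) (f x) :=
        hi.trans _ _ _ (hle' y hy) (hi.trans _ _ _ hvw.1 (hge' x hx))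
      rcases hxy.2.2 _ hxfy' (hi.trans _ _ _ hfyx hfxy) with he | he
      · exact hxfy he.symm
      · exact hx (hlow _ _ hfxy (he ▸ hy))
  -- A `δ⁺` element of `U` cannot be interior, so `v` is an endpoint of `[l, r]` and everything
  -- beyond it is clamped to `v`.
  · intro hv
    rcases lt_or_gt_of_ne hvw.2.1 with hlt | hlt
    · refine Or.inr fun u hu => ?_
      have hlv : l = v := by
        by_contra hne
        exact (hwall v (lt_of_le_of_ne hl.1 hne) (hlt.trans_le hr.2)).1 hv hvU
      by_contra huv
      have : f u = v := by
        have := hf u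
        omega
      exact hu (show f u ∈ U from this ▸ hvU)
    · refine Or.inl fun u hu => ?_
      have hrv : r = v := by
        by_contra hne
        exact (hwall v (hl.2.trans_lt hlt) (lt_of_le_of_ne hr.1 (Ne.symm hne))).1 hv hvU
      by_contra huv
      have : f u = v := by
        have := hf u
        omega
      exact hu (show f u ∈ U from this ▸ hvU)
  · intro hw
    rcases lt_or_gt_of_ne hvw.2.1 with hlt | hlt
    · refine Or.inl fun u hu => ?_
      have hrw : r = w := by
        by_contra hne
        exact hwU ((hwall w (hl.1.trans_lt hlt) (lt_of_le_of_ne hr.2 (Ne.symm hne))).2 hw)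
      by_contra huv
      have : f u = w := by
        have := hf u
        omega
      exact hwU (this ▸ hu)
    · refine Or.inr fun u hu => ?_
      have hlw : l = w := by
        by_contra hne
        exact hwU ((hwall w (lt_of_le_of_ne hl.2 hne) (hlt.trans_le hr.1)).2 hw)
      by_contra huv
      have : f u = w := by
        have := hf u
        omega
      exact hwU (this ▸ hu)

theorem fromRel_cover_adj {x y : Fin n} :
    (SimpleGraph.fromRel R.Cover).Adj x y ↔ R.Cover x y ∨ R.Cover y x := by
  rw [SimpleGraph.fromRel_adj]
  exact and_iff_right_of_imp fun H => H.elim (fun H => H.2.1) (fun H => H.2.1.symm)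

/-- A cut of the Hasse diagram at `v w` bounds the components of the complement of this edge. -/
theorem reachable_deleteEdges_cut {A : Set (Fin n)} {v w x y : Fin n}
    (hA : ∀ x y, R.Cover x y → ¬ (x ∈ A ↔ y ∈ A) → x = v ∧ y = w)
    (h : ((SimpleGraph.fromRel R.Cover).deleteEdges {s(v, w)}).Reachable x y) :
    x ∈ A ↔ y ∈ A := by
  rw [SimpleGraph.reachable_iff_reflTransGen] at h
  induction h with
  | refl => exact Iff.rfl
  | @tail y z _ hyz ih =>
    rw [ih]
    rw [SimpleGraph.deleteEdges_adj, fromRel_cover_adj] at hyz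
    by_contra hne
    refine hyz.2 ?_
    rcases hyz.1 with hc | hc
    · obtain ⟨rfl, rfl⟩ := hA _ _ hc hne
      rfl
    · obtain ⟨rfl, rfl⟩ := hA _ _ hc (fun H => hne H.symm)
      exact Sym2.eq_swap

/-- Consecutive values are comparable, having no value between them to serve as a witness, so the
diagram is connected. Each cover is a bridge by `exists_cut`, so it is acyclic. -/
theorem isTree_cover [NeZero n] (h : IsPermutreePoset δ R) :
    (SimpleGraph.fromRel R.Cover).IsTree := by
  have hi := h.toIsIntervalPoset
  have hrel : ∀ x y, R.rel x y → (SimpleGraph.fromRel R.Cover).Reachable x y := by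
    intro x y hxy
    rw [SimpleGraph.reachable_iff_reflTransGen]
    exact Relation.ReflTransGen.mono (fun _ _ H => fromRel_cover_adj.2 (Or.inl H)) _ _
      (hi.reflTransGen_cover.2 hxy)
  have hsucc : ∀ (m : ℕ) (hm : m < n),
      (SimpleGraph.fromRel R.Cover).Reachable (0 : Fin n) ⟨m, hm⟩ := by
    intro m
    induction m with
    | zero => intro hm; exact SimpleGraph.Reachable.refl _
    | succ m ih =>
      intro hm
      refine (ih (by omega)).trans ?_
      by_cases h₁ : R.rel ⟨m, by omega⟩ ⟨m + 1, hm⟩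
      · exact hrel _ _ h₁
      by_cases h₂ : R.rel ⟨m + 1, hm⟩ ⟨m, by omega⟩
      · exact (hrel _ _ h₂).symm
      obtain ⟨b, hb, hb', _⟩ := h.incomparable ⟨m, by omega⟩ ⟨m + 1, hm⟩
        (Fin.mk_lt_mk.2 (Nat.lt_succ_self m)) h₁ h₂
      rw [Fin.lt_def] at hb hb'
      simp only at hb hb'
      omega
  refine ⟨⟨fun x y => (hsucc x x.2).symm.trans (hsucc y y.2)⟩, ?_⟩
  rw [SimpleGraph.isAcyclic_iff_forall_adj_isBridge]
  intro x y hxy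
  rw [SimpleGraph.isBridge_iff]
  intro hr
  rcases fromRel_cover_adj.1 hxy with hc | hc
  · obtain ⟨A, hx, hy, hA, _⟩ := h.exists_cut hc
    exact hy ((reachable_deleteEdges_cut hA hr).1 hx)
  · obtain ⟨A, hy, hx, hA, _⟩ := h.exists_cut hc
    rw [Sym2.eq_swap] at hr
    exact hx ((reachable_deleteEdges_cut hA hr).2 hy)

/-- The permutree whose oriented edges are the covers. -/
def permutree [NeZero n] (h : IsPermutreePoset δ R) : Permutree δ where
  edge := R.Cover
  asymm u v h₁ h₂ := h₁.2.1 (h.antisymm u v h₁.1 h₂.1)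
  isTree := h.isTree_cover
  one_parent _ hv _ _ := h.one_parent hv
  one_child _ hv _ _ h₁ h₂ := h.op.one_parent hv h₁.op h₂.op
  two_parents _ _ _ _ := h.two_parents
  two_children _ _ _ _ h₁ h₂ := h.op.two_parents h₁.op h₂.op
  ancestor_subtrees v hv w hvw := by
    obtain ⟨A, _, hw, hA, hpos, _⟩ := h.exists_cut hvw
    have hsub : ∀ u ∈ hangingSubtree (SimpleGraph.fromRel R.Cover) v w, u ∉ A :=
      fun u hu huA => hw ((reachable_deleteEdges_cut hA hu).2 huA)
    exact (hpos hv).imp (fun H u hu => H u (hsub u hu)) (fun H u hu => H u (hsub u hu))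
  descendant_subtrees v hv w hwv := by
    obtain ⟨A, hw, _, hA, _, hneg⟩ := h.exists_cut hwv
    have hsub : ∀ u ∈ hangingSubtree (SimpleGraph.fromRel R.Cover) v w, u ∈ A := by
      intro u hu
      have hu' : ((SimpleGraph.fromRel R.Cover).deleteEdges {s(w, v)}).Reachable w u := by
        rw [Sym2.eq_swap]
        exact hu
      exact (reachable_deleteEdges_cut hA hu').1 hw
    exact (hneg hv).imp (fun H u hu => H u (hsub u hu)) (fun H u hu => H u (hsub u hu))

end IsPermutreePoset

/-! ### The lattice and its sublattices -/

theorem mem_PEP_iff {n : ℕ} [NeZero n] {δ : PermutreeOrientation n} {R : IRel n} :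
    R ∈ PEP δ ↔ IsPermutreePoset δ R := by
  constructor
  · rintro ⟨T, rfl⟩
    exact T.isPermutreePoset
  · intro h
    refine ⟨h.permutree, ?_⟩
    ext u v
    exact h.toIsIntervalPoset.reflTransGen_cover

theorem PEP_subset_WOIP {n : ℕ} (δ : PermutreeOrientation n) : PEP δ ⊆ WOIP n := by
  rintro R ⟨T, rfl⟩
  exact mem_WOIP_iff.2 T.isPermutreePoset.toIsIntervalPoset

/-- A tree has a vertex. The case `n = 0` is apart because the local conditions hold vacuously
there. -/
theorem PEP_eq_empty (δ : PermutreeOrientation 0) : PEP δ = ∅ := by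
  refine Set.eq_empty_of_forall_notMem ?_
  rintro R ⟨T, rfl⟩
  exact T.isTree.connected.nonempty.some.elim0

theorem joinRel_mem_PEP {n : ℕ} {δ : PermutreeOrientation n} {R S : IRel n} (hR : R ∈ PEP δ)
    (hS : S ∈ PEP δ) : joinRel R S ∈ PEP δ := by
  rcases n with _ | n
  · rw [PEP_eq_empty] at hR
    exact hR.elim
  · rw [mem_PEP_iff] at hR hS ⊢
    exact isPermutreePoset_joinRel hR hS

theorem op_mem_WOIP {n : ℕ} {R : IRel n} (h : R ∈ WOIP n) : R.op ∈ WOIP n :=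
  mem_WOIP_iff.2 (mem_WOIP_iff.1 h).op

theorem joinRel_mem_WOIP {n : ℕ} {R S : IRel n} (hR : R ∈ WOIP n) (hS : S ∈ WOIP n) :
    joinRel R S ∈ WOIP n :=
  mem_WOIP_iff.2 (isIntervalPoset_joinRel (mem_WOIP_iff.1 hR) (mem_WOIP_iff.1 hS))

/-- The weak order on interval posets is a lattice. The meet is dual to the join. -/
abbrev latticeWOIP (n : ℕ) : Lattice (WOIP n) where
  sup R S := ⟨joinRel R S, joinRel_mem_WOIP R.2 S.2⟩
  inf R S := ⟨(joinRel R.1.op S.1.op).op,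
    op_mem_WOIP (joinRel_mem_WOIP (op_mem_WOIP R.2) (op_mem_WOIP S.2))⟩
  le_sup_left _ _ := le_joinRel_left
  le_sup_right _ _ := le_joinRel_right
  sup_le _ _ Z h₁ h₂ := joinRel_le (mem_WOIP_iff.1 Z.2) h₁ h₂
  inf_le_left R S := IRel.op_le_op (R := R.1.op) (S := joinRel R.1.op S.1.op) le_joinRel_left
  inf_le_right R S := IRel.op_le_op (R := S.1.op) (S := joinRel R.1.op S.1.op) le_joinRel_right
  le_inf Z _ _ h₁ h₂ := IRel.op_le_op
    (joinRel_le (mem_WOIP_iff.1 Z.2).op (IRel.op_le_op h₁) (IRel.op_le_op h₂))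

theorem mainTheorem6 (n : ℕ) (δ : PermutreeOrientation n) :
    PEP δ ⊆ WOIP n ∧
      ∃ L : Lattice (WOIP n),
        (∀ R S : WOIP n, L.le R S ↔ (R : IRel n) ≤ (S : IRel n)) ∧
          ∃ P : Sublattice (WOIP n), ∀ R : WOIP n, R ∈ P ↔ (R : IRel n) ∈ PEP δ := by
  refine ⟨PEP_subset_WOIP δ, latticeWOIP n, fun R S => Iff.rfl, ?_⟩
  let _ := latticeWOIP n
  exact ⟨{  carrier := {R | (R : IRel n) ∈ PEP δ}
            supClosed' := fun R hR S hS => joinRel_mem_PEP hR hS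
            -- The meet is the join conjugated by `op`, and `δ.op.op` is `δ` by definition.
            infClosed' := fun R hR S hS => Permutree.op_mem_PEP
              (joinRel_mem_PEP (Permutree.op_mem_PEP hR) (Permutree.op_mem_PEP hS)) },
    fun R => Iff.rfl⟩
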